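/- Let $R\ge 1$ be an integer and let $(U_m)_{m\ge 0}$ be a Markov chain with state space $\{1,\dots,R\}$ and transition probabilities $$p_{ij}=\mathbb{P}[U_{m+1}=j\mid U_m=i]=\begin{cases}1/i,& R-i<j\le R,\\ 0,&\text{otherwise,}\end{cases}$$ started from an arbitrary initial distribution on $\{1,\dots,R\}$ (in particular $U_0=1$, or the stationary distribution). For $n\ge 1$ let the hop count be $$H^{(n)}=\min\Big\{m:\ \sum_{i=1}^m U_i\ge n\Big\}.$$ Let $(V_m)_{m\ge0}$ be a stationary version of the chain (same transition probabilities, all $V_m$ with the same law), and put $$\mu_U=\mathbb{E}[V_0],\qquad \gamma_U^2=\mathrm{Var}[V_0]+2\sum_{j=1}^\infty \mathrm{Cov}[V_0,V_j].$$ Then the series converges, $\mu_U=\lim_{i\to\infty}\mathbb{E}[U_i]=\frac{2R+1}{3}$, $$\mathrm{Cov}[V_0,V_j]=\Big(-\frac12\Big)^j\,\frac{R^2+R-2}{18}\quad(j\ge 0),\qquad \gamma_U^2=\lim_{m\to\infty}\frac1m\,\mathrm{Var}\Big[\sum_{i=0}^m U_i\Big],$$ and $$\lim_{n\to\infty}\frac{\mathrm{Var}[H^{(n)}]}{n}=\sigma_H^2:=\frac{\gamma_U^2}{\mu_U^3}=\frac{R^2+R-2}{16R^3+24R^2+12R+2}.$$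 -/

import Mathlib

open MeasureTheory ProbabilityTheory Filter Topology

/-- Transition probability from state `i` to state `j` (both in `{1, ..., R}`): given that `i` nodes
were newly updated, the next number of newly updated nodes is uniform on
`{R - i + 1, ..., R}`. The condition `R - i < j` is written without subtraction. -/
noncomputable def transProb (R i j : ℕ) : ℝ :=
  if R < i + j ∧ j ≤ R then 1 / (i : ℝ) else 0

/-- `U` is a Markov chain under `P` with state space `{1, ..., R}` and transition probabilities
`transProb R`. The initial distribution is an arbitrary law on `{1, ..., R}`.
The Markov property is stated in multiplied-out form, so that histories of probability zero
impose no condition. -/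
structure IsUpdateChain {Ω : Type*} [MeasurableSpace Ω] (R : ℕ) (U : ℕ → Ω → ℕ)
    (P : Measure Ω) : Prop where
  measurable : ∀ m, Measurable (U m)
  mem_states : ∀ m, ∀ᵐ ω ∂P, 1 ≤ U m ω ∧ U m ω ≤ R
  markov : ∀ (m : ℕ) (u : ℕ → ℕ),
    P.real {ω | ∀ i ≤ m + 1, U i ω = u i} =
      P.real {ω | ∀ i ≤ m, U i ω = u i} * transProb R (u m) (u (m + 1))

/-- `U` is such a Markov chain in steady state: all `U m` have the same law. -/
structure IsStationaryUpdateChain {Ω : Type*} [MeasurableSpace Ω] (R : ℕ) (U : ℕ → Ω → ℕ)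
    (P : Measure Ω) : Prop extends IsUpdateChain R U P where
  identDistrib : ∀ m, IdentDistrib (U m) (U 0) P P

/-- The hop count `H^(n) = min {m : U_1 + ... + U_m ≥ n}`. -/
noncomputable def hopCount {Ω : Type*} (U : ℕ → Ω → ℕ) (n : ℕ) (ω : Ω) : ℕ :=
  sInf {m : ℕ | n ≤ ∑ i ∈ Finset.Icc 1 m, U i ω}

/-- The steady-state mean `μ_U = E[V_0]`, for a stationary chain `V`. -/
noncomputable def steadyMean {Ω : Type*} [MeasurableSpace Ω] (V : ℕ → Ω → ℕ)
    (P : Measure Ω) : ℝ :=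
  ∫ ω, (V 0 ω : ℝ) ∂P

/-- `Cov[V_0, V_j]`. -/
noncomputable def autoCov {Ω : Type*} [MeasurableSpace Ω] (V : ℕ → Ω → ℕ)
    (P : Measure Ω) (j : ℕ) : ℝ :=
  covariance (fun ω => (V 0 ω : ℝ)) (fun ω => (V j ω : ℝ)) P

/-- The asymptotic variance constant `γ_U² = Var[V_0] + 2 ∑_{j ≥ 1} Cov[V_0, V_j]`,
for a stationary chain `V`. -/
noncomputable def gammaSq {Ω : Type*} [MeasurableSpace Ω] (V : ℕ → Ω → ℕ)
    (P : Measure Ω) : ℝ :=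
  variance (fun ω => (V 0 ω : ℝ)) P + 2 * ∑' j : ℕ, autoCov V P (j + 1)

/-! No renewal theorem or CLT is needed: everything follows from martingales and bounded stopping
times. The one-step mean from state `i` is `(2R+1-i)/2`, affine with slope `-1/2`, so the increments
`meanIncr` sum to `3/2 (S_t - μ t)` plus a boundary term, where `S_t = U_1 + ... + U_t` and `μ =
(2R+1)/3` (`sum_range_meanIncr`). Stopped at a bounded stopping time `τ`, this martingale `M` has
mean zero, and its second moment is the expected sum of the conditional variances `(U_k² - 1)/12`
over `k < τ`. That sum is `(R²+R-2)/24 · τ` up to martingale and boundary terms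
(`sum_range_variance`), hence `E[M_τ²] = (R²+R-2)/24 · E[τ] + O(1)`
(`abs_integral_transform_sq_sub_le`).

For `τ = m`, `S_m = (2/3) M_m + μ m + O(1)` gives the growth rate `(R²+R-2)/54`. For `τ = H^(n) ≤
n`, the overshoot is bounded, so `H^(n) = n/μ - (2/(3μ)) M_τ + O(1)`, which gives both `E[H^(n)]/n →
1/μ` and the variance rate. `tendsto_variance_div` absorbs the bounded errors. For the stationary
chain, the same affine recursion gives geometric autocovariances. -/

/-! ### Finite histories and one-step moments. -/

/-- Extend a finite history `(w_0, ..., w_k)` by zeros to an infinite path. -/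
def extendHistory (k : ℕ) (w : Fin (k + 1) → ℕ) (i : ℕ) : ℕ :=
  if h : i < k + 1 then w ⟨i, h⟩ else 0

/-- A functional of the past factors through the countable type `Fin (k + 1) → ℕ`; measurability,
boundedness and the partition into histories all rest on this. -/
lemma DependsOn.apply_extendHistory {k : ℕ} {φ : (ℕ → ℕ) → ℝ} (hφ : DependsOn φ (Set.Iic k))
    (u : ℕ → ℕ) : φ (extendHistory k fun i => u i) = φ u := by
  apply hφ
  intro i hi
  have : i < k + 1 := Nat.lt_succ_of_le hi
  simp [extendHistory, this]

/-- The expectation of `f` after one step of the chain from `i`. -/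
noncomputable def transMean (R : ℕ) (f : ℕ → ℝ) (i : ℕ) : ℝ :=
  ∑ j ∈ Finset.Icc 1 R, transProb R i j * f j

/-- The substitution `t = R - j` fixes the lower end of the summation range, so that moments can be
computed by induction on its length. -/
lemma transMean_eq_sum_range {R i : ℕ} (hi : i ≤ R) (f : ℕ → ℝ) :
    transMean R f i = (1 / (i : ℝ)) * ∑ t ∈ Finset.range i, f (R - t) := by
  unfold transMean transProb
  simp_rw [ite_mul, zero_mul]
  rw [← Finset.sum_filter, ← Finset.mul_sum]
  congr 1
  refine Finset.sum_bij' (fun j _ => R - j) (fun t _ => R - t) ?_ ?_ ?_ ?_ ?_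
  · intro j hj
    simp only [Finset.mem_filter, Finset.mem_Icc, Finset.mem_range] at hj ⊢
    omega
  · intro t ht
    simp only [Finset.mem_filter, Finset.mem_Icc, Finset.mem_range] at ht ⊢
    omega
  · intro j hj
    simp only [Finset.mem_filter, Finset.mem_Icc] at hj
    omega
  · intro t ht
    simp only [Finset.mem_range] at ht
    omega
  · intro j hj
    simp only [Finset.mem_filter, Finset.mem_Icc] at hj
    congr 1
    omega

lemma transMean_id {R i : ℕ} (h1 : 1 ≤ i) (hi : i ≤ R) :
    transMean R (fun j => (j : ℝ)) i = (2 * R + 1 - i) / 2 := by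
  have key : ∀ n : ℕ, n ≤ R →
      ∑ t ∈ Finset.range n, ((R - t : ℕ) : ℝ) = n * ((2 * R + 1 - n) / 2) := by
    intro n hn
    induction n with
    | zero => simp
    | succ n ih =>
      rw [Finset.sum_range_succ, ih (by omega), Nat.cast_sub (by omega)]
      push_cast
      ring
  have : (i : ℝ) ≠ 0 := by positivity
  rw [transMean_eq_sum_range hi, key i hi]
  field_simp

/-- Squared mean plus `(i² - 1)/12`, the variance of a uniform law on `i` consecutive integers. -/
lemma transMean_sq {R i : ℕ} (h1 : 1 ≤ i) (hi : i ≤ R) :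
    transMean R (fun j => (j : ℝ) ^ 2) i =
      ((2 * R + 1 - i) / 2) ^ 2 + ((i : ℝ) ^ 2 - 1) / 12 := by
  have key : ∀ n : ℕ, n ≤ R →
      ∑ t ∈ Finset.range n, ((R - t : ℕ) : ℝ) ^ 2 =
        n * (((2 * R + 1 - n) / 2) ^ 2 + ((n : ℝ) ^ 2 - 1) / 12) := by
    intro n hn
    induction n with
    | zero => simp
    | succ n ih =>
      rw [Finset.sum_range_succ, ih (by omega), Nat.cast_sub (by omega)]
      push_cast
      ring
  have : (i : ℝ) ≠ 0 := by positivity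
  rw [transMean_eq_sum_range hi, key i hi]
  field_simp

/-! ### The Markov property for functionals of the past. -/

namespace IsUpdateChain

variable {R : ℕ} {Ω : Type*} [MeasurableSpace Ω] {P : Measure Ω} {U : ℕ → Ω → ℕ}

lemma ae_mem_states (hU : IsUpdateChain R U P) : ∀ᵐ ω ∂P, ∀ m, 1 ≤ U m ω ∧ U m ω ≤ R :=
  ae_all_iff.2 hU.mem_states

lemma measurable_history (hU : IsUpdateChain R U P) (k : ℕ) :
    Measurable fun ω (i : Fin (k + 1)) => U i ω :=
  measurable_pi_lambda _ fun i => hU.measurable i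

lemma measurable_comp (hU : IsUpdateChain R U P) {k : ℕ} {φ : (ℕ → ℕ) → ℝ}
    (hφ : DependsOn φ (Set.Iic k)) : Measurable fun ω => φ fun i => U i ω := by
  have h : (fun ω => φ fun i => U i ω) =
      (fun w => φ (extendHistory k w)) ∘ fun ω (i : Fin (k + 1)) => U i ω := by
    funext ω
    exact (hφ.apply_extendHistory fun i => U i ω).symm
  rw [h]
  exact (measurable_of_countable _).comp (hU.measurable_history k)

/-- Almost surely only the finitely many histories in `{1, ..., R}^(k+1)` occur, so the functional
is bounded by the sum of its absolute values over them. -/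
lemma memLp_comp [IsProbabilityMeasure P] (hU : IsUpdateChain R U P) {k : ℕ} {φ : (ℕ → ℕ) → ℝ}
    (hφ : DependsOn φ (Set.Iic k)) (p : ENNReal) : MemLp (fun ω => φ fun i => U i ω) p P := by
  refine MemLp.of_bound (hU.measurable_comp hφ).aestronglyMeasurable
    (∑ w ∈ Fintype.piFinset fun _ : Fin (k + 1) => Finset.Icc 1 R, ‖φ (extendHistory k w)‖) ?_
  filter_upwards [hU.ae_mem_states] with ω hω
  rw [← hφ.apply_extendHistory fun i => U i ω]
  refine Finset.single_le_sum (f := fun w => ‖φ (extendHistory k w)‖)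
    (fun _ _ => norm_nonneg _) ?_
  simpa [Fintype.mem_piFinset] using fun i : Fin (k + 1) => hω i

lemma integrable_comp [IsProbabilityMeasure P] (hU : IsUpdateChain R U P) {k : ℕ}
    {φ : (ℕ → ℕ) → ℝ} (hφ : DependsOn φ (Set.Iic k)) :
    Integrable (fun ω => φ fun i => U i ω) P :=
  memLp_one_iff_integrable.1 (hU.memLp_comp hφ 1)

lemma measurableSet_history (hU : IsUpdateChain R U P) (k : ℕ) (u : ℕ → ℕ) :
    MeasurableSet {ω | ∀ i ≤ k, U i ω = u i} := by
  simp_rw [Set.ofPred_forall]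
  exact MeasurableSet.iInter fun i => MeasurableSet.iInter fun _ =>
    hU.measurable i (measurableSet_singleton _)

lemma setIntegral_history [IsProbabilityMeasure P] (hU : IsUpdateChain R U P) (k : ℕ)
    (u : ℕ → ℕ) (f : ℕ → ℝ) :
    ∫ ω in {ω | ∀ i ≤ k, U i ω = u i}, f (U (k + 1) ω) ∂P =
      ∫ ω in {ω | ∀ i ≤ k, U i ω = u i}, transMean R f (U k ω) ∂P := by
  have hA := hU.measurableSet_history k u
  have hright : ∫ ω in {ω | ∀ i ≤ k, U i ω = u i}, transMean R f (U k ω) ∂P =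
      P.real {ω | ∀ i ≤ k, U i ω = u i} * transMean R f (u k) := by
    rw [setIntegral_congr_fun (g := fun _ => transMean R f (u k)) hA, setIntegral_const, smul_eq_mul]
    intro ω hω
    simp only [Set.mem_ofPred_eq] at hω
    simp only [hω k le_rfl]
  have hleft : (fun ω => f (U (k + 1) ω)) =ᵐ[P.restrict {ω | ∀ i ≤ k, U i ω = u i}]
      fun ω => ∑ j ∈ Finset.Icc 1 R, (U (k + 1) ⁻¹' {j}).indicator (fun _ => f j) ω := by
    filter_upwards [ae_restrict_of_ae hU.ae_mem_states] with ω hω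
    rw [Finset.sum_eq_single (U (k + 1) ω)]
    · simp
    · intro j _ hj
      exact Set.indicator_of_notMem (by simpa using hj.symm) _
    · intro h
      exact absurd (Finset.mem_Icc.2 (hω (k + 1))) h
  have hm : ∀ j, MeasurableSet (U (k + 1) ⁻¹' {j}) := fun j =>
    hU.measurable _ (measurableSet_singleton j)
  rw [hright, integral_congr_ae hleft, integral_finsetSum, transMean, Finset.mul_sum]
  · refine Finset.sum_congr rfl fun j _ => ?_
    -- The path follows `u` up to time `k` and then takes the value `j`.
    have hmk := hU.markov k fun i => if i ≤ k then u i else j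
    have e1 : {ω | ∀ i ≤ k + 1, U i ω = if i ≤ k then u i else j} =
        U (k + 1) ⁻¹' {j} ∩ {ω | ∀ i ≤ k, U i ω = u i} := by
      ext ω
      simp only [Set.mem_ofPred_eq, Set.mem_inter_iff, Set.mem_preimage, Set.mem_singleton_iff]
      constructor
      · intro h
        refine ⟨by simpa using h (k + 1) le_rfl, fun i hi => ?_⟩
        simpa [hi] using h i (by omega)
      · rintro ⟨h1, h2⟩ i hi
        split_ifs with hik
        · exact h2 i hik
        · obtain rfl : i = k + 1 := by omega
          exact h1
    have e2 : {ω | ∀ i ≤ k, U i ω = if i ≤ k then u i else j} =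
        {ω | ∀ i ≤ k, U i ω = u i} := by
      ext ω
      refine forall₂_congr fun i hi => ?_
      simp [hi]
    rw [e1, e2] at hmk
    rw [if_pos le_rfl, if_neg (Nat.not_succ_le_self k)] at hmk
    rw [integral_indicator (hm j), Measure.restrict_restrict (hm j), setIntegral_const, hmk,
      smul_eq_mul, mul_assoc]
  · intro j _
    exact (integrable_const _).indicator (hm j)

/-- The Markov property, for a function of the past times a function of the next state. -/
lemma integral_mul_next [IsProbabilityMeasure P] (hU : IsUpdateChain R U P) {k : ℕ}
    {φ : (ℕ → ℕ) → ℝ} (hφ : DependsOn φ (Set.Iic k)) (f : ℕ → ℝ) :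
    ∫ ω, φ (fun i => U i ω) * f (U (k + 1) ω) ∂P =
      ∫ ω, φ (fun i => U i ω) * transMean R f (U k ω) ∂P := by
  -- The countably many values of the history partition `Ω`; on each piece `φ` is constant and can
  -- be pulled out.
  set W : Ω → Fin (k + 1) → ℕ := fun ω i => U i ω with hW
  have hs : ∀ w, MeasurableSet (W ⁻¹' {w}) := fun w =>
    hU.measurable_history k (measurableSet_singleton w)
  have hd : Pairwise (Function.onFun Disjoint fun w => W ⁻¹' {w}) := fun a b hab =>
    Disjoint.preimage _ (by simpa using hab)
  have hun : ⋃ w, W ⁻¹' {w} = Set.univ := by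
    ext ω
    simp
  have hset : ∀ w, W ⁻¹' {w} = {ω | ∀ i ≤ k, U i ω = extendHistory k w i} := by
    intro w
    ext ω
    simp only [hW, Set.mem_preimage, Set.mem_singleton_iff, funext_iff, Set.mem_ofPred_eq]
    constructor
    · intro h i hi
      have : i < k + 1 := Nat.lt_succ_of_le hi
      simpa [extendHistory, this] using h ⟨i, this⟩
    · intro h i
      simpa [extendHistory, Nat.le_of_lt_succ i.2] using h i (Nat.le_of_lt_succ i.2)
  have i1 : Integrable (fun ω => φ (fun i => U i ω) * f (U (k + 1) ω)) P := by
    refine hU.integrable_comp (k := k + 1) (φ := fun u => φ u * f (u (k + 1))) ?_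
    intro u v huv
    have h1 : φ u = φ v := hφ fun i hi => huv i (le_trans hi (Nat.le_succ k))
    simp only [h1, huv (k + 1) Set.self_mem_Iic]
  have i2 : Integrable (fun ω => φ (fun i => U i ω) * transMean R f (U k ω)) P := by
    refine hU.integrable_comp (k := k) (φ := fun u => φ u * transMean R f (u k)) ?_
    intro u v huv
    simp only [hφ huv, huv k Set.self_mem_Iic]
  rw [← setIntegral_univ, ← hun, integral_iUnion hs hd i1.integrableOn, ← setIntegral_univ (μ := P),
    ← hun, integral_iUnion hs hd i2.integrableOn]
  refine tsum_congr fun w => ?_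
  have hc : ∀ g : Ω → ℝ, ∫ ω in W ⁻¹' {w}, φ (fun i => U i ω) * g ω ∂P =
      φ (extendHistory k w) * ∫ ω in W ⁻¹' {w}, g ω ∂P := by
    intro g
    rw [← integral_const_mul]
    refine setIntegral_congr_fun (hs w) fun ω hω => ?_
    have hω' : W ω = w := hω
    simp only [← hφ.apply_extendHistory fun i => U i ω, ← hω', hW]
  rw [hc, hc, hset, hU.setIntegral_history]

end IsUpdateChain

/-! ### Martingale differences and their conditional variance. -/

/-- The martingale difference `u_{k+1} - E[U_{k+1} | U_k = u_k]`. -/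
noncomputable def meanIncr (R : ℕ) (u : ℕ → ℕ) (k : ℕ) : ℝ :=
  (u (k + 1) : ℝ) - (2 * R + 1 - u k) / 2

/-- The martingale difference `u_{k+1}² - E[U_{k+1}² | U_k = u_k]`. -/
noncomputable def sqIncr (R : ℕ) (u : ℕ → ℕ) (k : ℕ) : ℝ :=
  (u (k + 1) : ℝ) ^ 2 - (((2 * R + 1 - u k) / 2) ^ 2 + ((u k : ℝ) ^ 2 - 1) / 12)

lemma dependsOn_meanIncr (R k : ℕ) :
    DependsOn (fun u => meanIncr R u k) (Set.Iic (k + 1)) := by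
  intro u v huv
  simp only [meanIncr, huv (k + 1) Set.self_mem_Iic, huv k (Nat.le_succ k)]

lemma dependsOn_sqIncr (R k : ℕ) :
    DependsOn (fun u => sqIncr R u k) (Set.Iic (k + 1)) := by
  intro u v huv
  simp only [sqIncr, huv (k + 1) Set.self_mem_Iic, huv k (Nat.le_succ k)]

lemma dependsOn_coord (f : ℕ → ℝ) (k : ℕ) : DependsOn (fun u : ℕ → ℕ => f (u k)) (Set.Iic k) := by
  intro u v huv
  simp only [huv k Set.self_mem_Iic]

lemma DependsOn.mul_Iic {k l m : ℕ} {φ ψ : (ℕ → ℕ) → ℝ} (hφ : DependsOn φ (Set.Iic k))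
    (hψ : DependsOn ψ (Set.Iic l)) (hk : k ≤ m) (hl : l ≤ m) :
    DependsOn (fun u => φ u * ψ u) (Set.Iic m) := by
  intro u v huv
  simp only [hφ fun i hi => huv i (le_trans hi hk), hψ fun i hi => huv i (le_trans hi hl)]

lemma DependsOn.sum_range {k : ℕ → ℕ} {N m : ℕ} {φ : ℕ → (ℕ → ℕ) → ℝ}
    (hφ : ∀ i, DependsOn (φ i) (Set.Iic (k i))) (hk : ∀ i < N, k i ≤ m) :
    DependsOn (fun u => ∑ i ∈ Finset.range N, φ i u) (Set.Iic m) := by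
  intro u v huv
  refine Finset.sum_congr rfl fun i hi => hφ i fun j hj => huv j ?_
  exact le_trans hj (hk i (Finset.mem_range.1 hi))

namespace IsUpdateChain

variable {R : ℕ} {Ω : Type*} [MeasurableSpace Ω] {P : Measure Ω} {U : ℕ → Ω → ℕ}

lemma integral_mul_meanIncr [IsProbabilityMeasure P] (hU : IsUpdateChain R U P) {k : ℕ}
    {φ : (ℕ → ℕ) → ℝ} (hφ : DependsOn φ (Set.Iic k)) :
    ∫ ω, φ (fun i => U i ω) * meanIncr R (fun i => U i ω) k ∂P = 0 := by
  simp only [meanIncr, mul_sub]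
  rw [integral_sub, hU.integral_mul_next hφ fun j => (j : ℝ), sub_eq_zero]
  · refine integral_congr_ae ?_
    filter_upwards [hU.ae_mem_states] with ω hω
    rw [transMean_id (hω k).1 (hω k).2]
  · exact hU.integrable_comp (φ := fun u => φ u * (u (k + 1) : ℝ))
      (hφ.mul_Iic (dependsOn_coord (fun j => (j : ℝ)) (k + 1)) (Nat.le_succ k) le_rfl)
  · exact hU.integrable_comp (φ := fun u => φ u * ((2 * R + 1 - (u k : ℝ)) / 2))
      (hφ.mul_Iic (dependsOn_coord (fun j => (2 * R + 1 - (j : ℝ)) / 2) k) le_rfl le_rfl)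

lemma integral_mul_sqIncr [IsProbabilityMeasure P] (hU : IsUpdateChain R U P) {k : ℕ}
    {φ : (ℕ → ℕ) → ℝ} (hφ : DependsOn φ (Set.Iic k)) :
    ∫ ω, φ (fun i => U i ω) * sqIncr R (fun i => U i ω) k ∂P = 0 := by
  simp only [sqIncr, mul_sub (φ _) ((U (k + 1) _ : ℝ) ^ 2)]
  rw [integral_sub, hU.integral_mul_next hφ fun j => (j : ℝ) ^ 2, sub_eq_zero]
  · refine integral_congr_ae ?_
    filter_upwards [hU.ae_mem_states] with ω hω
    rw [transMean_sq (hω k).1 (hω k).2]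
  · exact hU.integrable_comp (φ := fun u => φ u * (u (k + 1) : ℝ) ^ 2)
      (hφ.mul_Iic (dependsOn_coord (fun j => (j : ℝ) ^ 2) (k + 1)) (Nat.le_succ k) le_rfl)
  · exact hU.integrable_comp
      (φ := fun u => φ u * (((2 * R + 1 - (u k : ℝ)) / 2) ^ 2 + ((u k : ℝ) ^ 2 - 1) / 12))
      (hφ.mul_Iic (dependsOn_coord
        (fun j => ((2 * R + 1 - (j : ℝ)) / 2) ^ 2 + ((j : ℝ) ^ 2 - 1) / 12) k) le_rfl le_rfl)

/-- The square of `meanIncr` is `sqIncr` minus `(2R+1-u_k)` times `meanIncr` plus the conditional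
variance; the first two terms are orthogonal to the past. -/
lemma integral_mul_meanIncr_sq [IsProbabilityMeasure P] (hU : IsUpdateChain R U P) {k : ℕ}
    {φ : (ℕ → ℕ) → ℝ} (hφ : DependsOn φ (Set.Iic k)) :
    ∫ ω, φ (fun i => U i ω) * meanIncr R (fun i => U i ω) k ^ 2 ∂P =
      ∫ ω, φ (fun i => U i ω) * (((U k ω : ℝ) ^ 2 - 1) / 12) ∂P := by
  have hψ : DependsOn (fun u => φ u * (2 * R + 1 - (u k : ℝ))) (Set.Iic k) :=
    hφ.mul_Iic (dependsOn_coord (fun j => 2 * R + 1 - (j : ℝ)) k) le_rfl le_rfl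
  have h1 := hU.integral_mul_sqIncr hφ
  have h2 := hU.integral_mul_meanIncr hψ
  have i1 := hU.integrable_comp (hφ.mul_Iic (dependsOn_sqIncr R k) (Nat.le_succ k) le_rfl)
  have i2 := hU.integrable_comp (hψ.mul_Iic (dependsOn_meanIncr R k) (Nat.le_succ k) le_rfl)
  have i3 := hU.integrable_comp (hφ.mul_Iic
    (dependsOn_coord (fun j => ((j : ℝ) ^ 2 - 1) / 12) k) le_rfl le_rfl)
  have e : (fun ω => φ (fun i => U i ω) * meanIncr R (fun i => U i ω) k ^ 2) = fun ω =>
      (φ (fun i => U i ω) * sqIncr R (fun i => U i ω) k -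
        φ (fun i => U i ω) * (2 * R + 1 - (U k ω : ℝ)) * meanIncr R (fun i => U i ω) k) +
        φ (fun i => U i ω) * (((U k ω : ℝ) ^ 2 - 1) / 12) := by
    funext ω
    simp only [meanIncr, sqIncr]
    ring
  beta_reduce at h2 i2 i3
  rw [e, integral_add (by exact i1.sub i2) i3, integral_sub i1 i2, h1, h2, sub_zero, zero_add]

end IsUpdateChain

/-! ### Martingale transforms. -/

/-- The martingale transform of `meanIncr` by the weights `c`. -/
noncomputable def transform (R : ℕ) (c : ℕ → (ℕ → ℕ) → ℝ) (N : ℕ) (u : ℕ → ℕ) : ℝ :=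
  ∑ k ∈ Finset.range N, c k u * meanIncr R u k

lemma dependsOn_transform (R : ℕ) {c : ℕ → (ℕ → ℕ) → ℝ} (hc : ∀ k, DependsOn (c k) (Set.Iic k))
    (N : ℕ) : DependsOn (transform R c N) (Set.Iic N) :=
  DependsOn.sum_range (k := fun k => k + 1)
    (fun k => (hc k).mul_Iic (dependsOn_meanIncr R k) (Nat.le_succ k) le_rfl) fun _ h => h

namespace IsUpdateChain

variable {R : ℕ} {Ω : Type*} [MeasurableSpace Ω] {P : Measure Ω} {U : ℕ → Ω → ℕ}
  {c : ℕ → (ℕ → ℕ) → ℝ}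

lemma integral_transform [IsProbabilityMeasure P] (hU : IsUpdateChain R U P)
    (hc : ∀ k, DependsOn (c k) (Set.Iic k)) (N : ℕ) :
    ∫ ω, transform R c N (fun i => U i ω) ∂P = 0 := by
  simp only [transform]
  rw [integral_finsetSum]
  · exact Finset.sum_eq_zero fun k _ => hU.integral_mul_meanIncr (hc k)
  · intro k _
    exact hU.integrable_comp ((hc k).mul_Iic (dependsOn_meanIncr R k) (Nat.le_succ k) le_rfl)

/-- Cross terms vanish because the earlier sum and the weight `c N` are known at time `N`. The
condition `c² = c` makes the weights indicators. -/
lemma integral_transform_sq [IsProbabilityMeasure P] (hU : IsUpdateChain R U P)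
    (hc : ∀ k, DependsOn (c k) (Set.Iic k)) (hc2 : ∀ k u, c k u ^ 2 = c k u) (N : ℕ) :
    ∫ ω, transform R c N (fun i => U i ω) ^ 2 ∂P =
      ∫ ω, ∑ k ∈ Finset.range N, c k (fun i => U i ω) * (((U k ω : ℝ) ^ 2 - 1) / 12) ∂P := by
  have i3 : ∀ k, Integrable
      (fun ω => c k (fun i => U i ω) * (((U k ω : ℝ) ^ 2 - 1) / 12)) P := fun k =>
    hU.integrable_comp ((hc k).mul_Iic
      (dependsOn_coord (fun j => ((j : ℝ) ^ 2 - 1) / 12) k) le_rfl le_rfl)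
  rw [integral_finsetSum _ fun k _ => i3 k]
  induction N with
  | zero => simp [transform]
  | succ N ih =>
    have hψ : DependsOn (fun u => transform R c N u * c N u) (Set.Iic N) :=
      (dependsOn_transform R hc N).mul_Iic (hc N) le_rfl le_rfl
    have e : (fun ω => transform R c (N + 1) (fun i => U i ω) ^ 2) = fun ω =>
        transform R c N (fun i => U i ω) ^ 2 +
        2 * (transform R c N (fun i => U i ω) * c N (fun i => U i ω) *
          meanIncr R (fun i => U i ω) N) +
        c N (fun i => U i ω) * meanIncr R (fun i => U i ω) N ^ 2 := by
      funext ω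
      simp only [transform, Finset.sum_range_succ]
      linear_combination meanIncr R (fun i => U i ω) N ^ 2 * hc2 N fun i => U i ω
    have j1 := (hU.memLp_comp (dependsOn_transform R hc N) 2).integrable_sq
    have j2 := (hU.integrable_comp
      (hψ.mul_Iic (dependsOn_meanIncr R N) (Nat.le_succ N) le_rfl)).const_mul 2
    have hsq : DependsOn (fun u => meanIncr R u N ^ 2) (Set.Iic (N + 1)) := fun u v huv => by
      simp only [dependsOn_meanIncr R N huv]
    have j3 := hU.integrable_comp ((hc N).mul_Iic hsq (Nat.le_succ N) le_rfl)
    rw [e, integral_add (by exact j1.add j2) j3, integral_add j1 j2, integral_const_mul,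
      hU.integral_mul_meanIncr hψ, hU.integral_mul_meanIncr_sq (hc N), ih,
      Finset.sum_range_succ]
    ring

lemma integral_sum_mul_sqIncr [IsProbabilityMeasure P] (hU : IsUpdateChain R U P)
    (hc : ∀ k, DependsOn (c k) (Set.Iic k)) (N : ℕ) :
    ∫ ω, ∑ k ∈ Finset.range N, c k (fun i => U i ω) * sqIncr R (fun i => U i ω) k ∂P = 0 := by
  rw [integral_finsetSum]
  · exact Finset.sum_eq_zero fun k _ => hU.integral_mul_sqIncr (hc k)
  · intro k _
    exact hU.integrable_comp ((hc k).mul_Iic (dependsOn_sqIncr R k) (Nat.le_succ k) le_rfl)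

end IsUpdateChain

/-! ### Pathwise summation identities. -/

lemma sum_range_ite_lt_mul {t N : ℕ} (h : t ≤ N) (a : ℕ → ℝ) :
    ∑ k ∈ Finset.range N, (if k < t then (1 : ℝ) else 0) * a k = ∑ k ∈ Finset.range t, a k := by
  simp_rw [ite_mul, one_mul, zero_mul]
  rw [← Finset.sum_filter]
  congr 1
  ext k
  simp only [Finset.mem_filter, Finset.mem_range]
  omega

lemma sum_range_meanIncr (R : ℕ) (u : ℕ → ℕ) (t : ℕ) :
    ∑ k ∈ Finset.range t, meanIncr R u k =
      3 / 2 * (∑ i ∈ Finset.Icc 1 t, (u i : ℝ) - (2 * R + 1) / 3 * t) + (u 0 - u t) / 2 := by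
  induction t with
  | zero => simp
  | succ t ih =>
    rw [Finset.sum_range_succ, ih, Finset.sum_Icc_succ_top (by omega), meanIncr]
    push_cast
    ring

/-- The weight `1/8` matches the quadratic terms, since `sqIncr` contains `u_{k+1}² - u_k²/3`; the
multiple of `meanIncr` then cancels the linear terms. What remains is a drift proportional to `t`
and a telescoped boundary term. -/
lemma sum_range_variance (R : ℕ) (u : ℕ → ℕ) (t : ℕ) :
    ∑ k ∈ Finset.range t, ((u k : ℝ) ^ 2 - 1) / 12 =
      ((R : ℝ) ^ 2 + R - 2) / 24 * t + 1 / 8 * ∑ k ∈ Finset.range t, sqIncr R u k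
        - (2 * R + 1) / 24 * ∑ k ∈ Finset.range t, meanIncr R u k
        + (1 / 8 * ((u 0 : ℝ) ^ 2 - u t ^ 2) + (2 * R + 1) / 24 * (u t - u 0)) := by
  induction t with
  | zero => simp
  | succ t ih =>
    simp only [Finset.sum_range_succ]
    rw [ih, meanIncr, sqIncr]
    push_cast
    ring

lemma abs_sq_sub_add_le {R a b : ℕ} (hR : 1 ≤ R) (ha : a ≤ R) (hb : b ≤ R) :
    |1 / 8 * ((a : ℝ) ^ 2 - b ^ 2) + (2 * R + 1) / 24 * (b - a)| ≤ (R : ℝ) ^ 2 := by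
  have hR' : (1 : ℝ) ≤ R := by exact_mod_cast hR
  have ha' : (a : ℝ) ≤ R := by exact_mod_cast ha
  have hb' : (b : ℝ) ≤ R := by exact_mod_cast hb
  have ha0 : (0 : ℝ) ≤ a := Nat.cast_nonneg a
  have hb0 : (0 : ℝ) ≤ b := Nat.cast_nonneg b
  rw [abs_le]
  constructor <;> nlinarith [mul_nonneg ha0 (sub_nonneg.2 hR'), mul_nonneg hb0 (sub_nonneg.2 hR'),
    mul_le_mul ha' ha' ha0 (by positivity), mul_le_mul hb' hb' hb0 (by positivity),
    mul_nonneg ha0 (sub_nonneg.2 ha'), mul_nonneg hb0 (sub_nonneg.2 hb')]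

/-! ### Bounded stopping times. -/

namespace IsUpdateChain

variable {R : ℕ} {Ω : Type*} [MeasurableSpace Ω] {P : Measure Ω} {U : ℕ → Ω → ℕ}
  {c : ℕ → (ℕ → ℕ) → ℝ} {τ : Ω → ℕ} {N : ℕ}

/-- A stopping time is encoded by the weights `c k`, almost surely the indicators of `k < τ`.
Dependence of `c k` on the first states up to time `k` is the stopping property, and `N` is a
deterministic bound. -/
lemma ae_stoppingTime_eq_sum
    (hτ : ∀ᵐ ω ∂P, τ ω ≤ N ∧ ∀ k, c k (fun i => U i ω) = if k < τ ω then 1 else 0) :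
    (fun ω => (τ ω : ℝ)) =ᵐ[P] fun ω => ∑ k ∈ Finset.range N, c k (fun i => U i ω) := by
  filter_upwards [hτ] with ω hω
  have := sum_range_ite_lt_mul hω.1 fun _ => 1
  simp only [mul_one] at this
  simp only [hω.2, this]
  simp

lemma memLp_stoppingTime [IsProbabilityMeasure P] (hU : IsUpdateChain R U P)
    (hc : ∀ k, DependsOn (c k) (Set.Iic k))
    (hτ : ∀ᵐ ω ∂P, τ ω ≤ N ∧ ∀ k, c k (fun i => U i ω) = if k < τ ω then 1 else 0)
    (p : ENNReal) : MemLp (fun ω => (τ ω : ℝ)) p P := by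
  rw [memLp_congr_ae (ae_stoppingTime_eq_sum hτ)]
  exact hU.memLp_comp (DependsOn.sum_range (k := fun k => k) hc fun _ h => h.le) p

lemma ae_transform_eq
    (hτ : ∀ᵐ ω ∂P, τ ω ≤ N ∧ ∀ k, c k (fun i => U i ω) = if k < τ ω then 1 else 0) :
    ∀ᵐ ω ∂P, transform R c N (fun i => U i ω) =
      3 / 2 * (∑ i ∈ Finset.Icc 1 (τ ω), (U i ω : ℝ) - (2 * R + 1) / 3 * τ ω)
        + (U 0 ω - U (τ ω) ω) / 2 := by
  filter_upwards [hτ] with ω hω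
  simp only [transform, hω.2]
  rw [sum_range_ite_lt_mul hω.1, sum_range_meanIncr]

/-- Up to a bounded error, the second moment of the stopped martingale is proportional to the
expectation of the stopping time. -/
lemma abs_integral_transform_sq_sub_le [IsProbabilityMeasure P] (hU : IsUpdateChain R U P)
    (hR : 1 ≤ R) (hc : ∀ k, DependsOn (c k) (Set.Iic k)) (hc2 : ∀ k u, c k u ^ 2 = c k u)
    (hτ : ∀ᵐ ω ∂P, τ ω ≤ N ∧ ∀ k, c k (fun i => U i ω) = if k < τ ω then 1 else 0) :
    |∫ ω, transform R c N (fun i => U i ω) ^ 2 ∂P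
      - ((R : ℝ) ^ 2 + R - 2) / 24 * ∫ ω, (τ ω : ℝ) ∂P| ≤ (R : ℝ) ^ 2 := by
  have i1 : Integrable (fun ω => ∑ k ∈ Finset.range N,
      c k (fun i => U i ω) * (((U k ω : ℝ) ^ 2 - 1) / 12)) P :=
    hU.integrable_comp (DependsOn.sum_range (k := fun k => k) (m := N) (fun k => (hc k).mul_Iic
      (dependsOn_coord (fun j => ((j : ℝ) ^ 2 - 1) / 12) k) le_rfl le_rfl) fun _ h => h.le)
  have i2 : Integrable (fun ω => ((R : ℝ) ^ 2 + R - 2) / 24 * (τ ω : ℝ)) P :=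
    (memLp_one_iff_integrable.1 (hU.memLp_stoppingTime hc hτ 1)).const_mul _
  have i3 : Integrable (fun ω => 1 / 8 * ∑ k ∈ Finset.range N,
      c k (fun i => U i ω) * sqIncr R (fun i => U i ω) k) P :=
    (hU.integrable_comp (DependsOn.sum_range (k := fun k => k + 1) (m := N) (fun k =>
      (hc k).mul_Iic (dependsOn_sqIncr R k) (Nat.le_succ k) le_rfl) fun _ h => h)).const_mul _
  have i4 : Integrable (fun ω => (2 * (R : ℝ) + 1) / 24 * transform R c N (fun i => U i ω)) P :=
    (hU.integrable_comp (dependsOn_transform R hc N)).const_mul _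
  have e : ∫ ω, transform R c N (fun i => U i ω) ^ 2 ∂P
      - ((R : ℝ) ^ 2 + R - 2) / 24 * ∫ ω, (τ ω : ℝ) ∂P =
      ∫ ω, (1 / 8 * ((U 0 ω : ℝ) ^ 2 - U (τ ω) ω ^ 2)
        + (2 * R + 1) / 24 * (U (τ ω) ω - U 0 ω)) ∂P := by
    have h : ∫ ω, (((∑ k ∈ Finset.range N, c k (fun i => U i ω) * (((U k ω : ℝ) ^ 2 - 1) / 12)
        - ((R : ℝ) ^ 2 + R - 2) / 24 * (τ ω : ℝ))
        - 1 / 8 * ∑ k ∈ Finset.range N, c k (fun i => U i ω) * sqIncr R (fun i => U i ω) k)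
        + (2 * (R : ℝ) + 1) / 24 * transform R c N (fun i => U i ω)) ∂P =
        ∫ ω, (1 / 8 * ((U 0 ω : ℝ) ^ 2 - U (τ ω) ω ^ 2)
        + (2 * R + 1) / 24 * (U (τ ω) ω - U 0 ω)) ∂P := by
      refine integral_congr_ae ?_
      filter_upwards [hτ] with ω hω
      simp only [transform, hω.2]
      rw [sum_range_ite_lt_mul hω.1, sum_range_ite_lt_mul hω.1, sum_range_ite_lt_mul hω.1,
        sum_range_variance R fun i => U i ω]
      ring
    -- Both martingale terms have mean zero, so only the boundary term survives.
    rw [← h, integral_add (by exact (i1.sub i2).sub i3) i4, integral_sub (by exact i1.sub i2) i3,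
      integral_sub i1 i2, integral_const_mul, integral_const_mul, integral_const_mul,
      hU.integral_transform hc, hU.integral_sum_mul_sqIncr hc, hU.integral_transform_sq hc hc2]
    ring
  rw [e, ← Real.norm_eq_abs]
  refine (norm_integral_le_of_norm_le_const (C := (R : ℝ) ^ 2) ?_).trans (by simp)
  filter_upwards [hU.ae_mem_states] with ω hω
  exact abs_sq_sub_add_le hR (hω 0).2 (hω _).2

end IsUpdateChain

/-! ### Linear growth of variances. -/

/-- Bounded perturbations and shifts do not change the linear growth rate of the variance. -/
lemma tendsto_variance_div {Ω : Type*} [MeasurableSpace Ω] {P : Measure Ω}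
    [IsProbabilityMeasure P] {Y Z : ℕ → Ω → ℝ} {α K s : ℝ} {κ : ℕ → ℝ}
    (hY : ∀ n, AEStronglyMeasurable (Y n) P) (hZ : ∀ n, MemLp (Z n) 2 P)
    (hZ0 : ∀ n, ∫ ω, Z n ω ∂P = 0)
    (hB : ∀ n, ∀ᵐ ω ∂P, |Y n ω - α * Z n ω - κ n| ≤ K)
    (hs : Tendsto (fun n : ℕ => (∫ ω, Z n ω ^ 2 ∂P) / n) atTop (𝓝 s)) :
    Tendsto (fun n : ℕ => variance (Y n) P / n) atTop (𝓝 (α ^ 2 * s)) := by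
  set B : ℕ → Ω → ℝ := fun n ω => Y n ω - α * Z n ω - κ n with hBdef
  have hBm : ∀ n, AEStronglyMeasurable (B n) P := fun n =>
    ((hY n).sub ((hZ n).aestronglyMeasurable.const_mul α)).sub aestronglyMeasurable_const
  have hBL : ∀ n, MemLp (B n) 2 P := fun n => MemLp.of_bound (hBm n) K (hB n)
  have hK : 0 ≤ K := by
    obtain ⟨ω, hω⟩ := (hB 0).exists
    exact (abs_nonneg _).trans hω
  -- With `B` bounded by `K`, the cross term is at most of order `√(E[Z²]) = O(√n)` and `Var B ≤
  -- K²`; both vanish after division by `n`.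
  have hvar : ∀ n, variance (Y n) P =
      α ^ 2 * ∫ ω, Z n ω ^ 2 ∂P + (2 * α * ∫ ω, Z n ω * B n ω ∂P + variance (B n) P) := by
    intro n
    have e : Y n = fun ω => (α * Z n ω + B n ω) + κ n := by
      funext ω
      simp only [hBdef]
      ring
    rw [e, variance_add_const
      (by exact ((hZ n).aestronglyMeasurable.const_mul α).add (hBm n)),
      variance_fun_add ((hZ n).const_mul α) (hBL n), variance_const_mul,
      covariance_const_mul_left, covariance_eq_sub (hZ n) (hBL n), variance_eq_sub (hZ n), hZ0]
    simp only [Pi.pow_apply, Pi.mul_apply]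
    ring
  have hvB : ∀ n, variance (B n) P ≤ K ^ 2 := by
    intro n
    have := variance_le_sq_of_bounded (μ := P) (a := -K) (b := K) (X := B n)
      (by filter_upwards [hB n] with ω hω using abs_le.1 hω) (hBm n).aemeasurable
    calc _ ≤ _ := this
      _ = _ := by ring
  have hcross : ∀ n, |∫ ω, Z n ω * B n ω ∂P| ≤ K * √(∫ ω, Z n ω ^ 2 ∂P) := by
    intro n
    have h1 : |∫ ω, Z n ω * B n ω ∂P| ≤ ∫ ω, K * |Z n ω| ∂P := by
      rw [← Real.norm_eq_abs]
      refine norm_integral_le_of_norm_le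
        (((hZ n).integrable one_le_two).abs.const_mul K) ?_
      filter_upwards [hB n] with ω hω
      rw [norm_mul, mul_comm]
      exact mul_le_mul_of_nonneg_right hω (abs_nonneg _)
    -- Nonnegativity of the variance of `|Z n|`.
    have h2 : (∫ ω, |Z n ω| ∂P) ≤ √(∫ ω, Z n ω ^ 2 ∂P) := by
      refine Real.le_sqrt_of_sq_le ?_
      have h3 := variance_nonneg (fun ω => |Z n ω|) P
      rw [variance_eq_sub (by exact (hZ n).abs)] at h3
      simp only [Pi.pow_apply, sq_abs] at h3
      linarith
    rw [integral_const_mul] at h1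
    exact h1.trans (mul_le_mul_of_nonneg_left h2 hK)
  have hinv : Tendsto (fun n : ℕ => (√(n : ℝ))⁻¹) atTop (𝓝 0) :=
    tendsto_inv_atTop_zero.comp (Real.tendsto_sqrt_atTop.comp tendsto_natCast_atTop_atTop)
  have hbound : Tendsto (fun n : ℕ => 2 * |α| * K * √((∫ ω, Z n ω ^ 2 ∂P) / n) * (√(n : ℝ))⁻¹
      + K ^ 2 * (n : ℝ)⁻¹) atTop (𝓝 0) := by
    have := ((hs.sqrt.const_mul (2 * |α| * K)).mul hinv).add
      (tendsto_inv_atTop_nhds_zero_nat (𝕜 := ℝ) |>.const_mul (K ^ 2))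
    simpa using this
  have herr : Tendsto (fun n : ℕ =>
      (2 * α * ∫ ω, Z n ω * B n ω ∂P + variance (B n) P) / n) atTop (𝓝 0) := by
    refine squeeze_zero_norm (fun n => ?_) hbound
    rw [Real.norm_eq_abs, abs_div, abs_of_nonneg (Nat.cast_nonneg n : (0 : ℝ) ≤ n)]
    have h1 : |2 * α * ∫ ω, Z n ω * B n ω ∂P + variance (B n) P| ≤
        2 * |α| * (K * √(∫ ω, Z n ω ^ 2 ∂P)) + K ^ 2 := by
      refine (abs_add_le _ _).trans (add_le_add ?_ ?_)
      · rw [abs_mul, abs_mul, abs_two]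
        exact mul_le_mul_of_nonneg_left (hcross n) (by positivity)
      · rw [abs_of_nonneg (variance_nonneg _ _)]
        exact hvB n
    refine (div_le_div_of_nonneg_right h1 (Nat.cast_nonneg n)).trans_eq ?_
    rw [Real.sqrt_div' _ (Nat.cast_nonneg n), add_div]
    congr 1
    have hn : (n : ℝ)⁻¹ = (√(n : ℝ))⁻¹ * (√(n : ℝ))⁻¹ := by
      rw [← mul_inv, Real.mul_self_sqrt (Nat.cast_nonneg n)]
    rw [div_eq_mul_inv, div_eq_mul_inv, hn]
    ring
  have := (hs.const_mul (α ^ 2)).add herr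
  rw [add_zero] at this
  refine this.congr fun n => ?_
  rw [hvar, add_div (α ^ 2 * _), mul_div_assoc (α ^ 2)]

/-! ### Means and variances of partial sums. -/

namespace IsUpdateChain

variable {R : ℕ} {Ω : Type*} [MeasurableSpace Ω] {P : Measure Ω} {U : ℕ → Ω → ℕ}

lemma memLp_coord [IsProbabilityMeasure P] (hU : IsUpdateChain R U P) (k : ℕ) (p : ENNReal) :
    MemLp (fun ω => (U k ω : ℝ)) p P :=
  hU.memLp_comp (dependsOn_coord (fun j => (j : ℝ)) k) p

lemma integrable_coord [IsProbabilityMeasure P] (hU : IsUpdateChain R U P) (k : ℕ) :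
    Integrable (fun ω => (U k ω : ℝ)) P :=
  memLp_one_iff_integrable.1 (hU.memLp_coord k 1)

lemma integral_mul_next_id [IsProbabilityMeasure P] (hU : IsUpdateChain R U P) {k : ℕ}
    {φ : (ℕ → ℕ) → ℝ} (hφ : DependsOn φ (Set.Iic k)) :
    ∫ ω, φ (fun i => U i ω) * (U (k + 1) ω : ℝ) ∂P =
      (2 * R + 1) / 2 * ∫ ω, φ (fun i => U i ω) ∂P
        - 1 / 2 * ∫ ω, φ (fun i => U i ω) * (U k ω : ℝ) ∂P := by
  have i1 : Integrable (fun ω => φ (fun i => U i ω) * (U k ω : ℝ)) P :=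
    hU.integrable_comp (hφ.mul_Iic (dependsOn_coord (fun j => (j : ℝ)) k) le_rfl le_rfl)
  rw [hU.integral_mul_next hφ fun j => (j : ℝ), ← integral_const_mul, ← integral_const_mul,
    ← integral_sub ((hU.integrable_comp hφ).const_mul _) (i1.const_mul _)]
  refine integral_congr_ae ?_
  filter_upwards [hU.ae_mem_states] with ω hω
  rw [transMean_id (hω k).1 (hω k).2]
  ring

lemma integral_next [IsProbabilityMeasure P] (hU : IsUpdateChain R U P) (k : ℕ) :
    ∫ ω, (U (k + 1) ω : ℝ) ∂P = (2 * R + 1) / 2 - 1 / 2 * ∫ ω, (U k ω : ℝ) ∂P := by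
  simpa using hU.integral_mul_next_id (k := k) (φ := fun _ => 1) fun _ _ _ => rfl

/-- The means iterate an affine map with slope `-1/2` and fixed point `(2R+1)/3`. -/
lemma integral_coord [IsProbabilityMeasure P] (hU : IsUpdateChain R U P) (k : ℕ) :
    ∫ ω, (U k ω : ℝ) ∂P =
      (2 * R + 1) / 3 + (-1 / 2) ^ k * (∫ ω, (U 0 ω : ℝ) ∂P - (2 * R + 1) / 3) := by
  induction k with
  | zero => simp
  | succ k ih =>
    rw [hU.integral_next, ih]
    ring

lemma tendsto_integral_coord [IsProbabilityMeasure P] (hU : IsUpdateChain R U P) :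
    Tendsto (fun k : ℕ => ∫ ω, (U k ω : ℝ) ∂P) atTop (𝓝 ((2 * R + 1) / 3)) := by
  have h : Tendsto (fun k : ℕ => (-1 / 2 : ℝ) ^ k) atTop (𝓝 0) :=
    tendsto_pow_atTop_nhds_zero_of_abs_lt_one (by norm_num [abs_div])
  have := (h.mul_const (∫ ω, (U 0 ω : ℝ) ∂P - (2 * R + 1) / 3)).const_add ((2 * (R : ℝ) + 1) / 3)
  rw [zero_mul, add_zero] at this
  exact this.congr fun k => (hU.integral_coord k).symm

lemma tendsto_integral_transform_sq_div [IsProbabilityMeasure P] (hU : IsUpdateChain R U P)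
    (hR : 1 ≤ R) {c : ℕ → ℕ → (ℕ → ℕ) → ℝ} {τ : ℕ → Ω → ℕ} {ρ : ℝ}
    (hc : ∀ n k, DependsOn (c n k) (Set.Iic k)) (hc2 : ∀ n k u, c n k u ^ 2 = c n k u)
    (hτ : ∀ n, ∀ᵐ ω ∂P, τ n ω ≤ n ∧ ∀ k, c n k (fun i => U i ω) = if k < τ n ω then 1 else 0)
    (hρ : Tendsto (fun n : ℕ => (∫ ω, (τ n ω : ℝ) ∂P) / n) atTop (𝓝 ρ)) :
    Tendsto (fun n : ℕ => (∫ ω, transform R (c n) n (fun i => U i ω) ^ 2 ∂P) / n) atTop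
      (𝓝 (((R : ℝ) ^ 2 + R - 2) / 24 * ρ)) := by
  have herr : Tendsto (fun n : ℕ => (∫ ω, transform R (c n) n (fun i => U i ω) ^ 2 ∂P
      - ((R : ℝ) ^ 2 + R - 2) / 24 * ∫ ω, (τ n ω : ℝ) ∂P) / n) atTop (𝓝 0) := by
    refine squeeze_zero_norm (a := fun n : ℕ => (R : ℝ) ^ 2 / n) (fun n => ?_)
      (tendsto_const_div_atTop_nhds_zero_nat _)
    rw [Real.norm_eq_abs, abs_div, abs_of_nonneg (Nat.cast_nonneg n : (0 : ℝ) ≤ n)]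
    exact div_le_div_of_nonneg_right
      (hU.abs_integral_transform_sq_sub_le hR (hc n) (hc2 n) (hτ n)) (Nat.cast_nonneg n)
  have := (hρ.const_mul (((R : ℝ) ^ 2 + R - 2) / 24)).add herr
  rw [add_zero] at this
  refine this.congr fun n => ?_
  ring

lemma tendsto_variance_sum_div [IsProbabilityMeasure P] (hU : IsUpdateChain R U P) (hR : 1 ≤ R) :
    Tendsto (fun m : ℕ =>
        variance (fun ω => ∑ i ∈ Finset.range (m + 1), (U i ω : ℝ)) P / (m : ℝ))
      atTop (𝓝 (((R : ℝ) ^ 2 + R - 2) / 54)) := by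
  set c : ℕ → ℕ → (ℕ → ℕ) → ℝ := fun m k _ => if k < m then 1 else 0 with hcdef
  have hc : ∀ m k, DependsOn (c m k) (Set.Iic k) := fun m k _ _ _ => rfl
  have hc2 : ∀ m k u, c m k u ^ 2 = c m k u := fun m k u => by
    simp only [hcdef]
    split_ifs <;> simp
  have hτ : ∀ m, ∀ᵐ ω ∂P, (fun _ => m : Ω → ℕ) ω ≤ m ∧
      ∀ k, c m k (fun i => U i ω) = if k < (fun _ => m : Ω → ℕ) ω then 1 else 0 := fun m =>
    Eventually.of_forall fun ω => ⟨le_rfl, fun k => rfl⟩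
  have hρ : Tendsto (fun m : ℕ => (∫ ω, (((fun _ => m : Ω → ℕ) ω : ℕ) : ℝ) ∂P) / m) atTop
      (𝓝 1) := by
    refine tendsto_const_nhds.congr' ?_
    filter_upwards [eventually_ne_atTop 0] with m hm
    simp [hm]
  -- Here `α = 2/3` inverts the factor `3/2` of `sum_range_meanIncr`; the remainder is `(2 U_0 +
  -- U_m)/3`, well within `K`.
  have key := tendsto_variance_div (P := P)
    (Y := fun m ω => ∑ i ∈ Finset.range (m + 1), (U i ω : ℝ))
    (Z := fun m ω => transform R (c m) m fun i => U i ω) (α := 2 / 3) (K := 2 * R)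
    (κ := fun m => (2 * R + 1) / 3 * m)
    (fun m => (Finset.measurable_fun_sum _ fun i _ =>
      measurable_from_top.comp (hU.measurable i)).aestronglyMeasurable)
    (fun m => hU.memLp_comp (dependsOn_transform R (hc m) m) 2)
    (fun m => hU.integral_transform (hc m) m) ?_
    (hU.tendsto_integral_transform_sq_div hR hc hc2 hτ hρ)
  · convert key using 2
    ring
  · intro m
    filter_upwards [hU.ae_mem_states, ae_transform_eq (R := R) (hτ m)] with ω hω hZ
    have hs : ∑ i ∈ Finset.range (m + 1), (U i ω : ℝ) =
        U 0 ω + ∑ i ∈ Finset.Icc 1 m, (U i ω : ℝ) := by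
      rw [Finset.range_eq_Ico, Finset.sum_eq_sum_Ico_succ_bot (Nat.succ_pos m)]
      rfl
    have h0 : (U 0 ω : ℝ) ≤ R := by exact_mod_cast (hω 0).2
    have hm : (U m ω : ℝ) ≤ R := by exact_mod_cast (hω m).2
    have h0' : (0 : ℝ) ≤ U 0 ω := Nat.cast_nonneg _
    have hm' : (0 : ℝ) ≤ U m ω := Nat.cast_nonneg _
    rw [hZ, hs, abs_le]
    constructor <;> linarith

end IsUpdateChain

/-! ### The hop count. -/

/-- On a path in `{1, ..., R}` the hop count is at most `n`, is the first passage time of the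
partial sums over `n`, and overshoots by at most `R`. -/
lemma hopCount_spec {Ω : Type*} {R : ℕ} {U : ℕ → Ω → ℕ} {ω : Ω}
    (hω : ∀ m, 1 ≤ U m ω ∧ U m ω ≤ R) (n : ℕ) :
    hopCount U n ω ≤ n ∧ (∀ k, k < hopCount U n ω ↔ ∑ i ∈ Finset.Icc 1 k, U i ω < n) ∧
      n ≤ ∑ i ∈ Finset.Icc 1 (hopCount U n ω), U i ω ∧
      ∑ i ∈ Finset.Icc 1 (hopCount U n ω), U i ω ≤ n + R := by
  have hmono : Monotone fun k => ∑ i ∈ Finset.Icc 1 k, U i ω := fun a b hab =>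
    Finset.sum_le_sum_of_subset (Finset.Icc_subset_Icc_right hab)
  have hn : n ∈ {m : ℕ | n ≤ ∑ i ∈ Finset.Icc 1 m, U i ω} := by
    have := Finset.card_nsmul_le_sum (Finset.Icc 1 n) (fun i => U i ω) 1 fun i _ => (hω i).1
    simpa using this
  have hmem : n ≤ ∑ i ∈ Finset.Icc 1 (hopCount U n ω), U i ω := Nat.sInf_mem ⟨n, hn⟩
  have hlt : ∀ k, k < hopCount U n ω → ∑ i ∈ Finset.Icc 1 k, U i ω < n := fun k hk =>
    not_le.1 fun h => hk.not_ge (Nat.sInf_le h)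
  refine ⟨Nat.sInf_le hn, fun k => ⟨hlt k, fun h => ?_⟩, hmem, ?_⟩
  · by_contra hk
    exact absurd (hmem.trans (hmono (not_lt.1 hk))) (not_le.2 h)
  · rcases Nat.eq_zero_or_pos (hopCount U n ω) with h0 | h0
    · simp [h0]
    · obtain ⟨k, hk⟩ := Nat.exists_eq_succ_of_ne_zero h0.ne'
      rw [hk, Nat.succ_eq_add_one, Finset.sum_Icc_succ_top (by omega)]
      exact Nat.add_le_add (hlt k (by omega)).le (hω _).2

namespace IsUpdateChain

variable {R : ℕ} {Ω : Type*} [MeasurableSpace Ω] {P : Measure Ω} {U : ℕ → Ω → ℕ}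

lemma tendsto_variance_hopCount_div [IsProbabilityMeasure P] (hU : IsUpdateChain R U P)
    (hR : 1 ≤ R) :
    Tendsto (fun n : ℕ => variance (fun ω => (hopCount U n ω : ℝ)) P / (n : ℝ)) atTop
      (𝓝 (((R : ℝ) ^ 2 + R - 2) / 54 / ((2 * R + 1) / 3) ^ 3)) := by
  -- The event `k < H^(n)` says that the sum up to time `k` is still below `n`, so it is decided by
  -- the states up to time `k`.
  set c : ℕ → ℕ → (ℕ → ℕ) → ℝ :=
    fun n k u => if ∑ i ∈ Finset.Icc 1 k, u i < n then 1 else 0 with hcdef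
  have hc : ∀ n k, DependsOn (c n k) (Set.Iic k) := fun n k u v huv => by
    have : ∑ i ∈ Finset.Icc 1 k, u i = ∑ i ∈ Finset.Icc 1 k, v i :=
      Finset.sum_congr rfl fun i hi => huv i (Finset.mem_Icc.1 hi).2
    simp only [hcdef, this]
  have hc2 : ∀ n k u, c n k u ^ 2 = c n k u := fun n k u => by
    simp only [hcdef]
    split_ifs <;> simp
  have hτ : ∀ n, ∀ᵐ ω ∂P, hopCount U n ω ≤ n ∧
      ∀ k, c n k (fun i => U i ω) = if k < hopCount U n ω then 1 else 0 := by
    intro n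
    filter_upwards [hU.ae_mem_states] with ω hω
    obtain ⟨h1, h2, -⟩ := hopCount_spec hω n
    exact ⟨h1, fun k => by simp only [hcdef, h2]⟩
  have hHL : ∀ n, MemLp (fun ω => (hopCount U n ω : ℝ)) 2 P := fun n =>
    hU.memLp_stoppingTime (hc n) (hτ n) 2
  have hZL : ∀ n, MemLp (fun ω => transform R (c n) n fun i => U i ω) 2 P := fun n =>
    hU.memLp_comp (dependsOn_transform R (hc n) n) 2
  have hμ : 0 < 2 * (R : ℝ) + 1 := by positivity
  -- Solving the stopped identity for `H^(n)` leaves the overshoot, in `[0, R]`, and the boundary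
  -- term `U_0 - U_H`.
  have hB : ∀ n : ℕ, ∀ᵐ ω ∂P, |(hopCount U n ω : ℝ)
      - (-2 / (2 * R + 1)) * transform R (c n) n (fun i => U i ω) - 3 / (2 * R + 1) * n| ≤
        6 * R / (2 * R + 1) := by
    intro n
    filter_upwards [hU.ae_mem_states, ae_transform_eq (R := R) (hτ n)] with ω hω hZ
    obtain ⟨-, -, h3, h4⟩ := hopCount_spec hω n
    have h3' : (n : ℝ) ≤ ∑ i ∈ Finset.Icc 1 (hopCount U n ω), (U i ω : ℝ) := by exact_mod_cast h3
    have h4' : ∑ i ∈ Finset.Icc 1 (hopCount U n ω), (U i ω : ℝ) ≤ n + R := by exact_mod_cast h4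
    have h0 : (U 0 ω : ℝ) ≤ R := by exact_mod_cast (hω 0).2
    have hm : (U (hopCount U n ω) ω : ℝ) ≤ R := by exact_mod_cast (hω _).2
    have h0' : (0 : ℝ) ≤ U 0 ω := Nat.cast_nonneg _
    have hm' : (0 : ℝ) ≤ U (hopCount U n ω) ω := Nat.cast_nonneg _
    have e : (hopCount U n ω : ℝ)
        - (-2 / (2 * R + 1)) * transform R (c n) n (fun i => U i ω) - 3 / (2 * R + 1) * n =
        (3 * (∑ i ∈ Finset.Icc 1 (hopCount U n ω), (U i ω : ℝ) - n)
          + (U 0 ω - U (hopCount U n ω) ω)) / (2 * R + 1) := by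
      rw [hZ]
      field_simp
      ring
    rw [e, abs_div, abs_of_pos hμ]
    refine div_le_div_of_nonneg_right ?_ hμ.le
    rw [abs_le]
    constructor <;> linarith
  -- A form of Wald's identity: taking expectations in `hB` removes the martingale.
  have hρ : Tendsto (fun n : ℕ => (∫ ω, (hopCount U n ω : ℝ) ∂P) / n) atTop
      (𝓝 (3 / (2 * R + 1))) := by
    have herr : Tendsto (fun n : ℕ => (∫ ω, ((hopCount U n ω : ℝ)
        - (-2 / (2 * R + 1)) * transform R (c n) n (fun i => U i ω)
        - 3 / (2 * R + 1) * n) ∂P) / n) atTop (𝓝 0) := by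
      refine squeeze_zero_norm (a := fun n : ℕ => 6 * R / (2 * R + 1) / (n : ℝ)) (fun n => ?_)
        (tendsto_const_div_atTop_nhds_zero_nat _)
      rw [norm_div, Real.norm_natCast]
      refine div_le_div_of_nonneg_right ?_ (Nat.cast_nonneg n)
      exact (norm_integral_le_of_norm_le_const (hB n)).trans (by simp)
    have := herr.add_const (3 / (2 * (R : ℝ) + 1))
    rw [zero_add] at this
    refine this.congr' ?_
    filter_upwards [eventually_ne_atTop 0] with n hn
    have hn' : (n : ℝ) ≠ 0 := by exact_mod_cast hn
    have i1 := (hHL n).integrable one_le_two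
    have i2 := ((hZL n).integrable one_le_two).const_mul (-2 / (2 * (R : ℝ) + 1))
    rw [integral_sub (by exact i1.sub i2) (integrable_const _), integral_sub i1 i2,
      integral_const_mul, hU.integral_transform (hc n)]
    simp only [integral_const, probReal_univ, one_smul]
    field_simp
    ring
  have key := tendsto_variance_div (P := P) (fun n => (hHL n).aestronglyMeasurable) hZL
    (fun n => hU.integral_transform (hc n) n) hB
    (hU.tendsto_integral_transform_sq_div hR hc hc2 hτ hρ)
  convert key using 2
  field_simp
  ring

end IsUpdateChain

/-! ### Moments and autocovariances of the stationary chain. -/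

namespace IsStationaryUpdateChain

variable {R : ℕ} {Ω : Type*} [MeasurableSpace Ω] {Q : Measure Ω} {V : ℕ → Ω → ℕ}

lemma integral_comp_eq (hV : IsStationaryUpdateChain R V Q) (f : ℕ → ℝ) (k : ℕ) :
    ∫ ω, f (V k ω) ∂Q = ∫ ω, f (V 0 ω) ∂Q :=
  ((hV.identDistrib k).comp (measurable_from_top (f := f))).integral_eq

lemma integral_coord_eq [IsProbabilityMeasure Q] (hV : IsStationaryUpdateChain R V Q) (k : ℕ) :
    ∫ ω, (V k ω : ℝ) ∂Q = (2 * R + 1) / 3 := by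
  have h1 := hV.integral_next 0
  have h2 := hV.integral_comp_eq (fun j => (j : ℝ)) (0 + 1)
  have h3 := hV.integral_comp_eq (fun j => (j : ℝ)) k
  linarith

lemma steadyMean_eq [IsProbabilityMeasure Q] (hV : IsStationaryUpdateChain R V Q) :
    steadyMean V Q = (2 * (R : ℝ) + 1) / 3 :=
  hV.integral_coord_eq 0

/-- By stationarity, the vanishing mean of `sqIncr` becomes a linear equation for the second moment,
with coefficient `1 - 1/3 = 2/3`. -/
lemma integral_sq_eq [IsProbabilityMeasure Q] (hV : IsStationaryUpdateChain R V Q) :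
    ∫ ω, (V 0 ω : ℝ) ^ 2 ∂Q = ((2 * R + 1) / 3) ^ 2 + ((R : ℝ) ^ 2 + R - 2) / 18 := by
  have h1 := hV.integral_mul_sqIncr (k := 0) (φ := fun _ => 1) fun _ _ _ => rfl
  have h2 := hV.integral_comp_eq (fun j => (j : ℝ) ^ 2) 1
  have h3 := hV.integral_coord_eq 0
  have e : (fun ω => 1 * sqIncr R (fun i => V i ω) 0) = fun ω => (V 1 ω : ℝ) ^ 2
      - (1 / 3 * (V 0 ω : ℝ) ^ 2 - (2 * R + 1) / 2 * (V 0 ω : ℝ)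
        + ((2 * R + 1) ^ 2 / 4 - 1 / 12)) := by
    funext ω
    simp only [sqIncr]
    ring
  have i1 := (hV.memLp_coord 1 2).integrable_sq
  have i2 := (hV.memLp_coord 0 2).integrable_sq.const_mul (1 / 3)
  have i3 := (hV.integrable_coord 0).const_mul ((2 * R + 1) / 2)
  rw [e, integral_sub i1 (by exact (i2.sub i3).add (integrable_const _)),
    integral_add (by exact i2.sub i3) (integrable_const _), integral_sub i2 i3,
    integral_const_mul, integral_const_mul, h2, h3] at h1
  simp only [integral_const, probReal_univ, one_smul] at h1
  linear_combination (3 / 2) * h1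

/-- Each step multiplies the covariance with `V_0` by the slope `-1/2` of the conditional mean. -/
lemma autoCov_eq [IsProbabilityMeasure Q] (hV : IsStationaryUpdateChain R V Q) (j : ℕ) :
    autoCov V Q j = (-1 / 2 : ℝ) ^ j * (((R : ℝ) ^ 2 + R - 2) / 18) := by
  have h : ∀ j, ∫ ω, (V 0 ω : ℝ) * (V j ω : ℝ) ∂Q =
      ((2 * R + 1) / 3) ^ 2 + (-1 / 2 : ℝ) ^ j * (((R : ℝ) ^ 2 + R - 2) / 18) := by
    intro j
    induction j with
    | zero =>
      simp only [← sq, hV.integral_sq_eq]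
      ring
    | succ j ih =>
      have hφ : DependsOn (fun u : ℕ → ℕ => (u 0 : ℝ)) (Set.Iic j) := fun u v huv => by
        simp only [huv 0 (Nat.zero_le j)]
      have := hV.integral_mul_next_id hφ
      beta_reduce at this
      rw [this, ih, hV.integral_coord_eq 0]
      ring
  rw [autoCov, covariance_eq_sub (hV.memLp_coord 0 2) (hV.memLp_coord j 2),
    hV.integral_coord_eq, hV.integral_coord_eq]
  simp only [Pi.mul_apply, h]
  ring

lemma hasSum_autoCov [IsProbabilityMeasure Q] (hV : IsStationaryUpdateChain R V Q) :
    HasSum (fun j => autoCov V Q (j + 1)) (-((R : ℝ) ^ 2 + R - 2) / 54) := by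
  have h := (hasSum_geometric_of_abs_lt_one (r := (-1 / 2 : ℝ)) (by norm_num [abs_div])).mul_left
    (-((R : ℝ) ^ 2 + R - 2) / 36)
  have e1 : (fun j => autoCov V Q (j + 1)) =
      fun j => -((R : ℝ) ^ 2 + R - 2) / 36 * (-1 / 2 : ℝ) ^ j := by
    funext j
    rw [hV.autoCov_eq]
    ring
  have e2 : -((R : ℝ) ^ 2 + R - 2) / 54 = -((R : ℝ) ^ 2 + R - 2) / 36 * (1 - -1 / 2)⁻¹ := by
    norm_num
    ring
  rw [e1, e2]
  exact h

lemma gammaSq_eq [IsProbabilityMeasure Q] (hV : IsStationaryUpdateChain R V Q) :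
    gammaSq V Q = ((R : ℝ) ^ 2 + R - 2) / 54 := by
  have h := hV.autoCov_eq 0
  rw [autoCov, covariance_self (hV.memLp_coord 0 2).aestronglyMeasurable.aemeasurable] at h
  rw [gammaSq, h, hV.hasSum_autoCov.tsum_eq]
  ring

end IsStationaryUpdateChain

theorem theorem1 (R : ℕ) (hR : 1 ≤ R)
    {Ω : Type*} [MeasurableSpace Ω] (P : Measure Ω) [IsProbabilityMeasure P]
    (U : ℕ → Ω → ℕ) (hU : IsUpdateChain R U P)
    {Ω' : Type*} [MeasurableSpace Ω'] (Q : Measure Ω') [IsProbabilityMeasure Q]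
    (V : ℕ → Ω' → ℕ) (hV : IsStationaryUpdateChain R V Q) :
    -- the steady-state mean is the limit of `E[U_i]`
    Tendsto (fun i : ℕ => ∫ ω, (U i ω : ℝ) ∂P) atTop (𝓝 (steadyMean V Q)) ∧
    steadyMean V Q = (2 * (R : ℝ) + 1) / 3 ∧
    -- the autocovariances of the stationary chain
    (∀ j : ℕ, autoCov V Q j = (-1 / 2 : ℝ) ^ j * (((R : ℝ) ^ 2 + R - 2) / 18)) ∧
    -- the series in `γ_U²` converges, and `γ_U²` is the asymptotic variance of the partial sums
    Summable (fun j : ℕ => autoCov V Q (j + 1)) ∧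
    Tendsto (fun m : ℕ =>
        variance (fun ω => ∑ i ∈ Finset.range (m + 1), (U i ω : ℝ)) P / (m : ℝ))
      atTop (𝓝 (gammaSq V Q)) ∧
    -- the variance of the hop count
    Tendsto (fun n : ℕ => variance (fun ω => (hopCount U n ω : ℝ)) P / (n : ℝ))
      atTop (𝓝 (gammaSq V Q / steadyMean V Q ^ 3)) ∧
    gammaSq V Q / steadyMean V Q ^ 3 =
      ((R : ℝ) ^ 2 + R - 2) / (16 * (R : ℝ) ^ 3 + 24 * (R : ℝ) ^ 2 + 12 * R + 2) := by
  have hμ : 2 * (R : ℝ) + 1 ≠ 0 := by positivity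
  rw [hV.gammaSq_eq, hV.steadyMean_eq]
  refine ⟨hU.tendsto_integral_coord, rfl, hV.autoCov_eq, hV.hasSum_autoCov.summable,
    hU.tendsto_variance_sum_div hR, hU.tendsto_variance_hopCount_div hR, ?_⟩
  -- The factor `2` is `54/27`, with `27` coming from `μ³ = (2R+1)³/27`.
  have h : 16 * (R : ℝ) ^ 3 + 24 * (R : ℝ) ^ 2 + 12 * R + 2 = 2 * (2 * R + 1) ^ 3 := by ring
  rw [h]
  field_simp
  ring
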